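/- Fix constants $0<\alpha<\frac12$, $c>0$, $0\le\gamma<\frac12$, $c_q>0$, $2\gamma<\gamma_q\le 1$, $0<\zeta_0<1$, $\bar c\ge 1$, $M_1>1$, $M_2>0$. For $n\ge1$, $p\ge 2$ let $Z=(Z_1,\dots,Z_n)$ with $Z_i=(y_i,X_{i\cdot})\in\mathbb R^{p+1}$ be i.i.d. with $y_i=X_{i\cdot}\beta+\epsilon_i$, where $X_{i\cdot}\sim N_p(0,\Omega^{-1})$ and $\epsilon_i\sim N(0,\sigma^2)$ are independent; write $\mathbb P_\theta,\mathbb E_\theta$ for the law of $Z$ with parameter $\theta=(\beta,\Omega,\sigma)$. For an integer $k\ge 0$ let $$\Theta(k)=\Big\{(\beta,\Omega,\sigma):\ \|\beta\|_0\le k,\ \tfrac1{M_1}\le\lambda_{\min}(\Omega)\le\lambda_{\max}(\Omega)\le M_1,\ 0<\sigma\le M_2\Big\},$$ where $\beta\in\mathbb R^p$, $\Omega\in\mathbb R^{p\times p}$ is symmetric and $\|\beta\|_0$ is the number of nonzero coordinates of $\beta$. For $\xi\in\mathbb R^p$ let $\mathcal I_\alpha(\Theta(k),\xi^{\intercal}\beta)$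 be the set of all intervals $\mathrm{CI}=[l(Z),u(Z)]$, with $l\le u$ measurable real functions of the data, such that $\inf_{\theta\in\Theta(k)}\mathbb P_\theta\big(l(Z)\le\xi^{\intercal}\beta\le u(Z)\big)\ge 1-\alpha$, and let $L(\mathrm{CI})=u(Z)-l(Z)$. Let $$\Xi(q,\bar c)=\Big\{\xi\in\mathbb R^p:\ \|\xi\|_0=q,\ \xi\ne0,\ \frac{\max_{j:\xi_j\neq 0}|\xi_j|}{\min_{j:\xi_j\neq 0}|\xi_j|}\le\bar c\Big\}.$$ Then there is a constant $c_1>0$, depending only on the constants fixed above, such that for all $n\ge 1$, $p\ge2$ and all integers $k,k_1,q\ge0$ with $$k\le c\min\Big\{p^{\gamma},\frac n{\log p}\Big\},\qquad q\ge c_q\,p^{\gamma_q},\qquad k_1\le(1-\zeta_0)k-1,$$ for every $\theta^*=(\beta^*,\mathrm I,\sigma)\in\Theta(k_1)$ and every $\xi\in\Xi(q,\bar c)$, $$\inf_{\mathrm{CI}\in\mathcal I_\alpha(\Theta(k),\,\xi^{\intercal}\beta)}\mathbb E_{\theta^*}L(\mathrm{CI})\ \ge\ c_1\,\|\xi\|_\infty\,k\,\sqrt{\frac{\log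 p}{n}}\;\sigma .$$ -/

import Mathlib

open MeasureTheory ProbabilityTheory
open scoped ENNReal

namespace HDRegression

/-- The `ℓ₀` "norm" of a vector: the number of its nonzero coordinates. -/
noncomputable def l0norm {p : ℕ} (x : Fin p → ℝ) : ℕ :=
  Set.ncard {j | x j ≠ 0}

/-- The `ℓ_∞` norm of a vector, `max_j |x_j|`. -/
noncomputable def linfNorm {p : ℕ} (x : Fin p → ℝ) : ℝ :=
  ⨆ j, |x j|

/-- The parameter `θ = (β, Ω, σ)`: regression vector, precision matrix of the design, and
noise level. -/
structure Param (p : ℕ) where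
  beta : Fin p → ℝ
  Omega : Matrix (Fin p) (Fin p) ℝ
  sigma : ℝ

/-- The parameter space `Θ(k)`: `k`-sparse regression vectors, symmetric precision matrices with
all eigenvalues in `[1 / M₁, M₁]`, noise levels in `(0, M₂]`. -/
def paramSpace (p : ℕ) (M₁ M₂ : ℝ) (k : ℕ) : Set (Param p) :=
  {θ | l0norm θ.beta ≤ k ∧
    (∃ h : θ.Omega.IsHermitian, ∀ i, 1 / M₁ ≤ h.eigenvalues i ∧ h.eigenvalues i ≤ M₁) ∧
    0 < θ.sigma ∧ θ.sigma ≤ M₂}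

/-- A single observation `Z_i = (y_i, X_i)`, with response `y_i` and design row `X_i`. -/
abbrev Observation (p : ℕ) : Type := ℝ × EuclideanSpace ℝ (Fin p)

/-- The law of a single observation: `y = Xᵀ β + ε` where `X ~ N_p(0, Ω⁻¹)` and
`ε ~ N(0, σ²)` are independent. -/
noncomputable def observationLaw {p : ℕ} (θ : Param p) : Measure (Observation p) :=
  ((multivariateGaussian 0 θ.Omega⁻¹).prod (gaussianReal 0 (θ.sigma ^ 2).toNNReal)).map
    (fun xe => (xe.1.ofLp ⬝ᵥ θ.beta + xe.2, xe.1))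

/-- The law `P_θ` of the data `Z = (Z_1, …, Z_n)`: `n` i.i.d. observations. -/
noncomputable def dataLaw (n : ℕ) {p : ℕ} (θ : Param p) : Measure (Fin n → Observation p) :=
  Measure.pi fun _ => observationLaw θ

/-- An interval-valued procedure `[l(Z), u(Z)]`, with measurable end points. -/
structure IntervalProcedure (n p : ℕ) where
  lower : (Fin n → Observation p) → ℝ
  upper : (Fin n → Observation p) → ℝ
  measurable_lower : Measurable lower
  measurable_upper : Measurable upper
  lower_le_upper : ∀ z, lower z ≤ upper z

/-- The set `I_α(Θ, T)` of confidence intervals for `T(β)` of level `1 - α` over `Θ`: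
`inf_{θ ∈ Θ} P_θ(l(Z) ≤ T(β) ≤ u(Z)) ≥ 1 - α`. -/
def confidenceIntervals (n : ℕ) {p : ℕ} (α : ℝ) (Θ : Set (Param p)) (T : (Fin p → ℝ) → ℝ) :
    Set (IntervalProcedure n p) :=
  {CI | ENNReal.ofReal (1 - α) ≤
    ⨅ θ ∈ Θ, dataLaw n θ {z | CI.lower z ≤ T θ.beta ∧ T θ.beta ≤ CI.upper z}}

/-- The expected length `E_θ (u(Z) - l(Z))`, possibly infinite; the length is nonnegative. -/
noncomputable def expectedLength {n p : ℕ} (θ : Param p) (CI : IntervalProcedure n p) : ℝ≥0∞ :=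
  ∫⁻ z, ENNReal.ofReal (CI.upper z - CI.lower z) ∂dataLaw n θ

/-- The loadings `Ξ(q, c̄)`: nonzero vectors with exactly `q` nonzero coordinates such that the
ratio of the largest to the smallest modulus of the nonzero coordinates is at most `c̄`
(equivalently, the ratio of any two of these moduli is at most `c̄`). -/
def loadings (p q : ℕ) (cbar : ℝ) : Set (Fin p → ℝ) :=
  {ξ | l0norm ξ = q ∧ ξ ≠ 0 ∧ ∀ i j, ξ i ≠ 0 → ξ j ≠ 0 → |ξ i| / |ξ j| ≤ cbar}

end HDRegression

namespace HDRegression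

open scoped NNReal

/-! The proof is Le Cam's method with a mixture of alternatives. Compare `(β, I, σ)` with `(β + δ,
I, √(σ² - d))`, where `d = δ ⬝ᵥ δ`. Lowering the noise by exactly `d` keeps the law of `y - Xβ`
equal to `N(0, σ²)`, so only its correlation with the design reveals `δ`. For two shifts of the same
norm, the product of the likelihood ratios of `n` observations then integrates to exactly `(1 - δ ⬝ᵥ
δ' / σ²)⁻ⁿ` (`lintegral_prod_likelihoodRatio_mul`).

If a mixture of alternatives, each moving the target by at least `Δ`, is close to the null in `χ²`,
then with positive probability a valid interval covers both the null value and that value plus `Δ`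
(`expectedLength_ge_of_mixture`).

The shifts have one entry `±ρ` in each of `s` disjoint blocks of `b` coordinates in the support of
`ξ`, with signs following `ξ`. They move `ξ ⬝ᵥ β` by at least `ρ s ‖ξ‖_∞ / cbar`. Two independent
uniform choices rarely agree in a block, and the second moment is at most `(1 + (exp (2nρ²/σ²) - 1)
/ b) ^ s`. With `s` of order `k`, `b = ⌊q/s⌋` and `ρ = a σ √(log p / n)`, its logarithm is at most a
multiple of `(k² / q) p^(2a²)`, which is small for small `a` and large `p` because `2γ < γq`. For
bounded `p`, both `k` and `log p` are bounded, and moving a single coordinate suffices. -/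

theorem lintegral_pi_prod {ι E : Type*} [Fintype ι] [MeasurableSpace E]
    (μ : ι → Measure E) [∀ i, IsProbabilityMeasure (μ i)] (f : ι → E → ℝ≥0∞)
    (hf : ∀ i, Measurable (f i)) :
    ∫⁻ x, ∏ i, f i (x i) ∂Measure.pi μ = ∏ i, ∫⁻ x, f i x ∂μ i := by
  have h := iIndepFun_pi (μ := μ) (X := f) (fun i => (hf i).aemeasurable)
  rw [lintegral_prod_eq_prod_lintegral_of_indepFun Finset.univ _ h
    (fun i => (hf i).comp (measurable_pi_apply i))]
  refine Finset.prod_congr rfl fun i _ => ?_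
  exact (measurePreserving_eval μ i).lintegral_comp (hf i)

theorem pi_withDensity {ι E : Type*} [Fintype ι] [MeasurableSpace E]
    (μ : Measure E) [IsProbabilityMeasure μ] (f : E → ℝ≥0∞) (hf : Measurable f)
    [IsProbabilityMeasure (μ.withDensity f)] :
    Measure.pi (fun _ : ι => μ.withDensity f) =
      (Measure.pi fun _ : ι => μ).withDensity (fun x => ∏ i, f (x i)) := by
  refine Measure.pi_eq fun s hs => ?_
  have hS : MeasurableSet (Set.univ.pi s) := MeasurableSet.univ_pi hs
  rw [withDensity_apply _ hS, ← lintegral_indicator hS]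
  have h1 : ∀ x : ι → E, (Set.univ.pi s).indicator (fun x => ∏ i, f (x i)) x =
      ∏ i, (s i).indicator f (x i) := by
    intro x
    by_cases hx : x ∈ Set.univ.pi s
    · rw [Set.indicator_of_mem hx]
      refine Finset.prod_congr rfl fun i _ => ?_
      rw [Set.indicator_of_mem (hx i trivial)]
    · rw [Set.indicator_of_notMem hx]
      simp only [Set.mem_pi, Set.mem_univ, true_implies, not_forall] at hx
      obtain ⟨i, hi⟩ := hx
      exact (Finset.prod_eq_zero (Finset.mem_univ i) (Set.indicator_of_notMem hi f)).symm
  simp_rw [h1]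
  rw [lintegral_pi_prod (fun _ => μ) (fun i => (s i).indicator f)
    (fun i => hf.indicator (hs i))]
  refine Finset.prod_congr rfl fun i _ => ?_
  rw [withDensity_apply _ (hs i), lintegral_indicator (hs i)]

/-- A density with `χ²`-divergence at most `t²` changes probabilities by at most `t`. -/
theorem setLIntegral_le_add_of_lintegral_sq_le {Ω : Type*} [MeasurableSpace Ω] (P : Measure Ω)
    [IsProbabilityMeasure P] (F : Ω → ℝ≥0∞) (hF : Measurable F) (h1 : ∫⁻ z, F z ∂P = 1)
    {t : ℝ≥0} (ht : 0 < t) (h2 : ∫⁻ z, F z * F z ∂P ≤ 1 + t ^ 2) {A : Set Ω}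
    (hA : MeasurableSet A) :
    ∫⁻ z in A, F z ∂P ≤ P A + t := by
  -- This is `2t·1_A·(F - 1) ≤ t² + (F - 1)²`, rearranged so that no subtraction occurs in `ℝ≥0∞`.
  have key : ∀ z, 2 * (t : ℝ≥0∞) * A.indicator F z + 2 * F z ≤
      2 * (t : ℝ≥0∞) * A.indicator 1 z + (t : ℝ≥0∞) ^ 2 + F z * F z + 1 := by
    intro z
    rcases eq_or_ne (F z) ⊤ with h | h
    · simp [h]
    · lift F z to ℝ≥0 using h with x hx
      by_cases hz : z ∈ A
      · rw [Set.indicator_of_mem hz, Set.indicator_of_mem hz, ← hx]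
        simp only [Pi.one_apply]
        norm_cast
        rw [← NNReal.coe_le_coe]
        push_cast
        nlinarith [sq_nonneg ((x : ℝ) - 1 - t)]
      · rw [Set.indicator_of_notMem hz, Set.indicator_of_notMem hz]
        norm_cast
        rw [← NNReal.coe_le_coe]
        push_cast
        nlinarith [sq_nonneg ((x : ℝ) - 1), sq_nonneg (t : ℝ)]
  have hint := lintegral_mono (μ := P) key
  rw [lintegral_add_left (by fun_prop (disch := assumption)),
    lintegral_add_right _ (by fun_prop), lintegral_add_right _ (by fun_prop),
    lintegral_add_right _ (by fun_prop), lintegral_const_mul _ (hF.indicator hA),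
    lintegral_const_mul _ hF, lintegral_const_mul _ (measurable_one.indicator hA),
    lintegral_indicator hA, lintegral_indicator_one hA, h1] at hint
  simp only [lintegral_const, measure_univ, mul_one] at hint
  have hfin : ∫⁻ z in A, F z ∂P ≠ ⊤ :=
    ne_top_of_le_ne_top (by simp [h1]) (setLIntegral_le_lintegral A F)
  have hfin' : P A ≠ ⊤ := measure_ne_top P A
  have hint2 := hint.trans (add_le_add (add_le_add le_rfl h2) le_rfl)
  lift ∫⁻ z in A, F z ∂P to ℝ≥0 using hfin with x
  lift P A to ℝ≥0 using hfin' with y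
  norm_cast at hint2 ⊢
  rw [← NNReal.coe_le_coe] at hint2 ⊢
  push_cast at hint2 ⊢
  have : (0 : ℝ) < t := ht
  nlinarith

/-! ### Gaussian integrals on the line -/

theorem lintegral_exp_mul_sq_gaussianReal (v : ℝ≥0) (A : ℝ) (h : 2 * A * v < 1) :
    ∫⁻ x, ENNReal.ofReal (Real.exp (A * x ^ 2)) ∂gaussianReal 0 v =
      ENNReal.ofReal ((√(1 - 2 * A * v))⁻¹) := by
  rcases eq_or_ne v 0 with rfl | hv
  · simp
  have hv' : (0 : ℝ) < v := by positivity
  have hD : 0 < 1 - 2 * A * v := by linarith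
  have hw : (0 : ℝ) < v / (1 - 2 * A * v) := by positivity
  rw [gaussianReal_of_var_ne_zero _ hv, lintegral_withDensity_eq_lintegral_mul _
    (measurable_gaussianPDF _ _) (by fun_prop)]
  -- The tilted density is a multiple of a centred Gaussian density of variance `v / (1 - 2Av)`.
  have h1 : ∀ x : ℝ, (gaussianPDF 0 v * fun x => ENNReal.ofReal (Real.exp (A * x ^ 2))) x =
      ENNReal.ofReal ((√(1 - 2 * A * v))⁻¹) *
        gaussianPDF 0 (v / (1 - 2 * A * v)).toNNReal x := by
    intro x
    rw [Pi.mul_apply, gaussianPDF, gaussianPDF, ← ENNReal.ofReal_mul (gaussianPDFReal_nonneg _ _ _),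
      ← ENNReal.ofReal_mul (by positivity), gaussianPDFReal, gaussianPDFReal,
      Real.coe_toNNReal _ hw.le, mul_assoc, ← Real.exp_add, ← mul_assoc, ← mul_inv,
      ← Real.sqrt_mul hD.le]
    have hD' : 1 - 2 * (v : ℝ) * A ≠ 0 := by linarith
    congr 4
    · field_simp
    · field_simp
      ring
  simp_rw [h1]
  rw [lintegral_const_mul _ (measurable_gaussianPDF _ _), lintegral_gaussianPDF_eq_one, mul_one]
  exact (Real.toNNReal_pos.2 hw).ne'

/-- Integrating out the residual in the product of two Gaussian likelihood ratios. -/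
theorem lintegral_gaussian_likelihood_mul {S d : ℝ} {v₀ v₁ : ℝ≥0} (hd : 0 ≤ d) (hdS : d < S)
    (h₀ : (v₀ : ℝ) = S) (h₁ : (v₁ : ℝ) = S - d) (u v : ℝ) :
    ∫⁻ r, ENNReal.ofReal (gaussianPDFReal u v₁ r / gaussianPDFReal 0 v₀ r) *
        ENNReal.ofReal (gaussianPDFReal v v₁ r / gaussianPDFReal 0 v₀ r) ∂gaussianReal 0 v₀ =
      ENNReal.ofReal (S / √((S + d) * (S - d))) *
        (ENNReal.ofReal (Real.exp (1 / (4 * (S + d)) * (u + v) ^ 2)) *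
          ENNReal.ofReal (Real.exp (-1 / (4 * (S - d)) * (u - v) ^ 2))) := by
  have hS : 0 < S := hd.trans_lt hdS
  have hSd : 0 < S - d := by linarith
  have hSd' : 0 < S + d := by linarith
  have hv₀ : v₀ ≠ 0 := by
    rintro rfl
    simp at h₀
    linarith
  have hv₁ : v₁ ≠ 0 := by
    rintro rfl
    simp at h₁
    linarith
  have hV : (0 : ℝ) < S * (S - d) / (S + d) := by positivity
  rw [gaussianReal_of_var_ne_zero _ hv₀, lintegral_withDensity_eq_lintegral_mul _
    (measurable_gaussianPDF _ _) (by fun_prop)]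
  -- Completing the square in `r` leaves a Gaussian density. The remaining exponent separates into
  -- `u + v` and `u - v`, which will be independent once the design is random.
  have hpt : ∀ r : ℝ, (gaussianPDF 0 v₀ * fun r =>
      ENNReal.ofReal (gaussianPDFReal u v₁ r / gaussianPDFReal 0 v₀ r) *
        ENNReal.ofReal (gaussianPDFReal v v₁ r / gaussianPDFReal 0 v₀ r)) r =
      (ENNReal.ofReal (S / √((S + d) * (S - d))) *
        (ENNReal.ofReal (Real.exp (1 / (4 * (S + d)) * (u + v) ^ 2)) *
          ENNReal.ofReal (Real.exp (-1 / (4 * (S - d)) * (u - v) ^ 2)))) *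
        gaussianPDF (S * (u + v) / (S + d)) (S * (S - d) / (S + d)).toNNReal r := by
    intro r
    have hp := gaussianPDFReal_pos 0 v₀ r hv₀
    have hu := gaussianPDFReal_nonneg u v₁ r
    have hv := gaussianPDFReal_nonneg v v₁ r
    rw [Pi.mul_apply, gaussianPDF, gaussianPDF, ← ENNReal.ofReal_mul (by positivity),
      ← ENNReal.ofReal_mul hp.le, ← ENNReal.ofReal_mul (by positivity),
      ← ENNReal.ofReal_mul (by positivity), ← ENNReal.ofReal_mul (by positivity)]
    congr 1
    have hq : gaussianPDFReal 0 v₀ r * (gaussianPDFReal u v₁ r / gaussianPDFReal 0 v₀ r *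
        (gaussianPDFReal v v₁ r / gaussianPDFReal 0 v₀ r)) =
        gaussianPDFReal u v₁ r * gaussianPDFReal v v₁ r * (gaussianPDFReal 0 v₀ r)⁻¹ := by
      field_simp
    rw [hq]
    simp only [gaussianPDFReal, Real.coe_toNNReal _ hV.le, h₀, h₁, mul_inv, inv_inv,
      ← Real.exp_neg]
    have e1 : (√(2 * Real.pi * (S - d)))⁻¹ * (√(2 * Real.pi * (S - d)))⁻¹ * √(2 * Real.pi * S) =
        S / √((S + d) * (S - d)) * (√(2 * Real.pi * (S * (S - d) / (S + d))))⁻¹ := by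
      have hpi := Real.pi_pos
      rw [← mul_inv, Real.mul_self_sqrt (by positivity), div_mul_eq_mul_div, ← div_eq_mul_inv,
        div_div, ← Real.sqrt_mul (by positivity)]
      have : 2 * Real.pi * (S * (S - d) / (S + d)) * ((S + d) * (S - d)) =
        (2 * Real.pi * S) * (S - d) ^ 2 := by field_simp
      rw [this, Real.sqrt_mul (show 0 ≤ 2 * Real.pi * S by positivity),
        Real.sqrt_sq hSd.le]
      have hs : 0 < √(2 * Real.pi * S) := by positivity
      have hs2 : √(2 * Real.pi * S) ^ 2 = 2 * Real.pi * S := Real.sq_sqrt (by positivity)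
      field_simp
      rw [hs2]
    have e2 : Real.exp (-(r - u) ^ 2 / (2 * (S - d))) * Real.exp (-(r - v) ^ 2 / (2 * (S - d))) *
        Real.exp (-(-(r - 0) ^ 2 / (2 * S))) =
        Real.exp (1 / (4 * (S + d)) * (u + v) ^ 2) * Real.exp (-1 / (4 * (S - d)) * (u - v) ^ 2) *
        Real.exp (-(r - S * (u + v) / (S + d)) ^ 2 / (2 * (S * (S - d) / (S + d)))) := by
      simp only [← Real.exp_add]
      congr 1
      field_simp
      ring
    calc _ = ((√(2 * Real.pi * (S - d)))⁻¹ * (√(2 * Real.pi * (S - d)))⁻¹ * √(2 * Real.pi * S)) *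
          (Real.exp (-(r - u) ^ 2 / (2 * (S - d))) * Real.exp (-(r - v) ^ 2 / (2 * (S - d))) *
            Real.exp (-(-(r - 0) ^ 2 / (2 * S)))) := by ring
      _ = _ := by
        rw [e1, e2]
        ring
  simp_rw [hpt]
  rw [lintegral_const_mul _ (measurable_gaussianPDF _ _), lintegral_gaussianPDF_eq_one, mul_one]
  exact (Real.toNNReal_pos.2 hV).ne'

/-! ### Linear functionals of the standard Gaussian design -/

variable {n p s b : ℕ}

theorem ofLp_dotProduct_eq_inner (w : Fin p → ℝ) (x : EuclideanSpace ℝ (Fin p)) :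
    x.ofLp ⬝ᵥ w = inner ℝ (WithLp.toLp 2 w) x := by
  simp [PiLp.inner_apply, dotProduct]

@[fun_prop]
theorem measurable_ofLp_dotProduct (w : Fin p → ℝ) :
    Measurable fun x : EuclideanSpace ℝ (Fin p) => x.ofLp ⬝ᵥ w := by
  simp_rw [ofLp_dotProduct_eq_inner]
  fun_prop

theorem covariance_dotProduct_stdGaussian (w w' : Fin p → ℝ) :
    cov[fun x : EuclideanSpace ℝ (Fin p) => x.ofLp ⬝ᵥ w, fun x => x.ofLp ⬝ᵥ w';
      stdGaussian (EuclideanSpace ℝ (Fin p))] = w ⬝ᵥ w' := by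
  simp_rw [ofLp_dotProduct_eq_inner]
  rw [← covarianceBilin_apply_eq_cov IsGaussian.memLp_two_id, covarianceBilin_stdGaussian,
    innerSL_apply_apply]
  rw [← ofLp_dotProduct_eq_inner, dotProduct_comm]

theorem hasGaussianLaw_dotProduct_pair (w w' : Fin p → ℝ) :
    HasGaussianLaw (fun x : EuclideanSpace ℝ (Fin p) => (x.ofLp ⬝ᵥ w, x.ofLp ⬝ᵥ w'))
      (stdGaussian (EuclideanSpace ℝ (Fin p))) := by
  simp_rw [ofLp_dotProduct_eq_inner]
  exact IsGaussian.hasGaussianLaw_id.map_fun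
    ((innerSL ℝ (WithLp.toLp 2 w)).prod (innerSL ℝ (WithLp.toLp 2 w')))

theorem map_dotProduct_stdGaussian (w : Fin p → ℝ) :
    (stdGaussian (EuclideanSpace ℝ (Fin p))).map (fun x => x.ofLp ⬝ᵥ w) =
      gaussianReal 0 (w ⬝ᵥ w).toNNReal := by
  rw [(hasGaussianLaw_dotProduct_pair w w).fst.map_eq_gaussianReal]
  congr 2
  · simp_rw [ofLp_dotProduct_eq_inner]
    exact integral_strongDual_stdGaussian (innerSL ℝ (WithLp.toLp 2 w))
  · rw [← covariance_self (by fun_prop), covariance_dotProduct_stdGaussian]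

theorem lintegral_exp_mul_sq_dotProduct (w : Fin p → ℝ) (A : ℝ) (h : 2 * A * (w ⬝ᵥ w) < 1) :
    ∫⁻ x : EuclideanSpace ℝ (Fin p), ENNReal.ofReal (Real.exp (A * (x.ofLp ⬝ᵥ w) ^ 2))
        ∂stdGaussian (EuclideanSpace ℝ (Fin p)) =
      ENNReal.ofReal ((√(1 - 2 * A * (w ⬝ᵥ w)))⁻¹) := by
  have hw : 0 ≤ w ⬝ᵥ w := by simpa using dotProduct_star_self_nonneg w
  have := lintegral_exp_mul_sq_gaussianReal (w ⬝ᵥ w).toNNReal A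
    (by rwa [Real.coe_toNNReal _ hw])
  rw [Real.coe_toNNReal _ hw, ← map_dotProduct_stdGaussian,
    lintegral_map (by fun_prop) (by fun_prop)] at this
  exact this

/-- Equal norms make `δ + δ'` and `δ - δ'` orthogonal, so the two linear forms are uncorrelated,
hence independent, and the integral factors. -/
theorem lintegral_exp_quadratic_pair (δ δ' : Fin p → ℝ) {S d : ℝ} (hdS : d < S)
    (h1 : δ ⬝ᵥ δ = d) (h2 : δ' ⬝ᵥ δ' = d) :
    ∫⁻ x : EuclideanSpace ℝ (Fin p),
      ENNReal.ofReal (Real.exp (1 / (4 * (S + d)) * (x.ofLp ⬝ᵥ δ + x.ofLp ⬝ᵥ δ') ^ 2)) *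
        ENNReal.ofReal (Real.exp (-1 / (4 * (S - d)) * (x.ofLp ⬝ᵥ δ - x.ofLp ⬝ᵥ δ') ^ 2))
        ∂stdGaussian (EuclideanSpace ℝ (Fin p)) =
      ENNReal.ofReal (√((S + d) * (S - d)) / (S - δ ⬝ᵥ δ')) := by
  have hd : 0 ≤ d := by
    rw [← h1]
    simpa using dotProduct_star_self_nonneg δ
  have hsum : (δ + δ') ⬝ᵥ (δ + δ') = 2 * (d + δ ⬝ᵥ δ') := by
    simp only [add_dotProduct, dotProduct_add, h1, h2, dotProduct_comm δ' δ]
    ring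
  have hdiff : (δ - δ') ⬝ᵥ (δ - δ') = 2 * (d - δ ⬝ᵥ δ') := by
    simp only [sub_dotProduct, dotProduct_sub, h1, h2, dotProduct_comm δ' δ]
    ring
  have hle : δ ⬝ᵥ δ' ≤ d := by
    have : 0 ≤ (δ - δ') ⬝ᵥ (δ - δ') := by simpa using dotProduct_star_self_nonneg (δ - δ')
    linarith
  have hS : 0 < S := by linarith
  have hSd : 0 < S - d := by linarith
  have hSd' : 0 < S + d := by linarith
  have hSh : 0 < S - δ ⬝ᵥ δ' := by linarith
  have horth : (δ + δ') ⬝ᵥ (δ - δ') = 0 := by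
    simp only [add_dotProduct, dotProduct_sub, h1, h2, dotProduct_comm δ' δ]
    ring
  have hind := (hasGaussianLaw_dotProduct_pair (δ + δ') (δ - δ')).indepFun_of_covariance_eq_zero
    (by rw [covariance_dotProduct_stdGaussian, horth])
  have hind' := hind.comp
    (φ := fun t : ℝ => ENNReal.ofReal (Real.exp (1 / (4 * (S + d)) * t ^ 2)))
    (ψ := fun t : ℝ => ENNReal.ofReal (Real.exp (-1 / (4 * (S - d)) * t ^ 2)))
    (by fun_prop) (by fun_prop)
  have hmul := lintegral_mul_eq_lintegral_mul_lintegral_of_indepFun''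
    (Measurable.aemeasurable (by fun_prop)) (Measurable.aemeasurable (by fun_prop)) hind'
  simp only [Function.comp_apply] at hmul
  have e1 : 1 - 2 * (1 / (4 * (S + d))) * (2 * (d + δ ⬝ᵥ δ')) = (S - δ ⬝ᵥ δ') / (S + d) := by
    field_simp
    ring
  have e2 : 1 - 2 * (-1 / (4 * (S - d))) * (2 * (d - δ ⬝ᵥ δ')) = (S - δ ⬝ᵥ δ') / (S - d) := by
    field_simp
    ring
  have p1 : 0 < (S - δ ⬝ᵥ δ') / (S + d) := by positivity
  have p2 : 0 < (S - δ ⬝ᵥ δ') / (S - d) := by positivity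
  rw [lintegral_exp_mul_sq_dotProduct _ _ (by rw [hsum]; linarith),
    lintegral_exp_mul_sq_dotProduct _ _ (by rw [hdiff]; linarith), hsum, hdiff, e1, e2,
    ← ENNReal.ofReal_mul (by positivity), ← mul_inv, ← Real.sqrt_mul p1.le, div_mul_div_comm,
    Real.sqrt_div (by positivity), Real.sqrt_mul_self hSh.le, inv_div] at hmul
  simp_rw [dotProduct_add, dotProduct_sub] at hmul
  exact hmul

/-! ### Likelihood ratios in the regression model -/

theorem lintegral_observationLaw (β : Fin p → ℝ) (σ : ℝ) (g : Observation p → ℝ≥0∞)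
    (hg : Measurable g) :
    ∫⁻ z, g z ∂observationLaw (⟨β, 1, σ⟩ : Param p) =
      ∫⁻ x, ∫⁻ e, g (x.ofLp ⬝ᵥ β + e, x) ∂gaussianReal 0 (σ ^ 2).toNNReal
        ∂stdGaussian (EuclideanSpace ℝ (Fin p)) := by
  have hm : Measurable fun xe : EuclideanSpace ℝ (Fin p) × ℝ =>
      (xe.1.ofLp ⬝ᵥ β + xe.2, xe.1) :=
    (((measurable_ofLp_dotProduct β).comp measurable_fst).add measurable_snd).prodMk measurable_fst
  rw [observationLaw]
  simp only [inv_one, multivariateGaussian_zero_one]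
  rw [lintegral_map hg hm]
  exact lintegral_prod _ (hg.comp hm).aemeasurable

instance isProbabilityMeasure_observationLaw (θ : Param p) :
    IsProbabilityMeasure (observationLaw θ) :=
  Measure.isProbabilityMeasure_map ((((measurable_ofLp_dotProduct θ.beta).comp
    measurable_fst).add measurable_snd).prodMk measurable_fst).aemeasurable

instance isProbabilityMeasure_dataLaw (n : ℕ) (θ : Param p) :
    IsProbabilityMeasure (dataLaw n θ) := by
  unfold dataLaw
  infer_instance

/-- The likelihood ratio of one observation between the parameters `(β + δ, I, √(σ² - d))` and
`(β, I, σ)`. -/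
noncomputable def likelihoodRatio (β : Fin p → ℝ) (σ d : ℝ) (δ : Fin p → ℝ) (z : Observation p) :
    ℝ≥0∞ :=
  ENNReal.ofReal (gaussianPDFReal (z.2.ofLp ⬝ᵥ δ) (σ ^ 2 - d).toNNReal (z.1 - z.2.ofLp ⬝ᵥ β) /
    gaussianPDFReal 0 (σ ^ 2).toNNReal (z.1 - z.2.ofLp ⬝ᵥ β))

@[fun_prop]
theorem measurable_likelihoodRatio (β : Fin p → ℝ) (σ d : ℝ) (δ : Fin p → ℝ) :
    Measurable (likelihoodRatio β σ d δ) := by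
  have h1 : ∀ w : Fin p → ℝ, Measurable fun z : Observation p => z.2.ofLp ⬝ᵥ w :=
    fun w => (measurable_ofLp_dotProduct w).comp measurable_snd
  have h2 : Measurable fun z : Observation p => z.1 - z.2.ofLp ⬝ᵥ β := measurable_fst.sub (h1 β)
  have h3 : Measurable fun z : Observation p =>
      (z.2.ofLp ⬝ᵥ δ, (σ ^ 2 - d).toNNReal, z.1 - z.2.ofLp ⬝ᵥ β) :=
    (h1 δ).prodMk (measurable_const.prodMk h2)
  exact ((measurable_uncurry_gaussianPDFReal.comp h3).div
    ((measurable_gaussianPDFReal 0 (σ ^ 2).toNNReal).comp h2)).ennreal_ofReal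

/-- The design has the same law under both parameters, so only the conditional laws of `y - Xβ`
given `X` have to be compared. -/
theorem observationLaw_eq_withDensity (β : Fin p → ℝ) {σ d : ℝ} (hd : 0 ≤ d) (hdσ : d < σ ^ 2)
    (δ : Fin p → ℝ) :
    observationLaw (⟨β + δ, 1, √(σ ^ 2 - d)⟩ : Param p) =
      (observationLaw (⟨β, 1, σ⟩ : Param p)).withDensity (likelihoodRatio β σ d δ) := by
  refine Measure.ext_of_lintegral _ fun g hg => ?_
  have hv₁ : (σ ^ 2 - d).toNNReal ≠ 0 := (Real.toNNReal_pos.2 (by linarith)).ne'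
  have hv₀ : (σ ^ 2).toNNReal ≠ 0 := (Real.toNNReal_pos.2 (by linarith)).ne'
  rw [lintegral_withDensity_eq_lintegral_mul _ (by fun_prop) hg, lintegral_observationLaw _ _ _ hg,
    lintegral_observationLaw _ _ _ (by fun_prop), Real.sq_sqrt (by linarith)]
  refine lintegral_congr fun x => ?_
  have hgm : ∀ c : ℝ, Measurable fun e : ℝ => g (c + e, x) :=
    fun c => hg.comp ((measurable_const_add c).prodMk measurable_const)
  have hshift : gaussianReal (x.ofLp ⬝ᵥ δ) (σ ^ 2 - d).toNNReal =
      (gaussianReal 0 (σ ^ 2 - d).toNNReal).map (x.ofLp ⬝ᵥ δ + ·) := by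
    rw [gaussianReal_map_const_add, zero_add]
  calc ∫⁻ e, g (x.ofLp ⬝ᵥ (β + δ) + e, x) ∂gaussianReal 0 (σ ^ 2 - d).toNNReal
      = ∫⁻ r, g (x.ofLp ⬝ᵥ β + r, x) ∂gaussianReal (x.ofLp ⬝ᵥ δ) (σ ^ 2 - d).toNNReal := by
        rw [hshift, lintegral_map (hgm _) (measurable_const_add _)]
        simp_rw [dotProduct_add, add_assoc]
    _ = _ := by
        have hlm : Measurable fun e : ℝ =>
            (likelihoodRatio β σ d δ * g) (x.ofLp ⬝ᵥ β + e, x) :=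
          ((measurable_likelihoodRatio β σ d δ).mul hg).comp
            ((measurable_const_add _).prodMk measurable_const)
        rw [gaussianReal_of_var_ne_zero _ hv₁, gaussianReal_of_var_ne_zero _ hv₀,
          lintegral_withDensity_eq_lintegral_mul _ (measurable_gaussianPDF _ _) (hgm _),
          lintegral_withDensity_eq_lintegral_mul _ (measurable_gaussianPDF _ _) hlm]
        refine lintegral_congr fun r => ?_
        have hp := gaussianPDFReal_pos 0 _ r hv₀
        simp only [Pi.mul_apply, likelihoodRatio, add_sub_cancel_left, gaussianPDF]
        rw [← mul_assoc, ← ENNReal.ofReal_mul hp.le, mul_div_cancel₀ _ hp.ne']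

/-- The residual is integrated out first, then the design; the factors `√((σ² + d)(σ² - d))` from
the two stages cancel. -/
theorem lintegral_likelihoodRatio_mul (β : Fin p → ℝ) {σ d : ℝ} (hdσ : d < σ ^ 2)
    (δ δ' : Fin p → ℝ) (h1 : δ ⬝ᵥ δ = d) (h2 : δ' ⬝ᵥ δ' = d) :
    ∫⁻ z, likelihoodRatio β σ d δ z * likelihoodRatio β σ d δ' z
        ∂observationLaw (⟨β, 1, σ⟩ : Param p) =
      ENNReal.ofReal ((1 - δ ⬝ᵥ δ' / σ ^ 2)⁻¹) := by
  have hd : 0 ≤ d := by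
    rw [← h1]
    simpa using dotProduct_star_self_nonneg δ
  have hS : 0 < σ ^ 2 := by linarith
  have hle : δ ⬝ᵥ δ' ≤ d := by
    have h3 : 0 ≤ (δ - δ') ⬝ᵥ (δ - δ') := by simpa using dotProduct_star_self_nonneg (δ - δ')
    simp only [sub_dotProduct, dotProduct_sub, h1, h2, dotProduct_comm δ' δ] at h3
    linarith
  rw [lintegral_observationLaw _ _ _ (by fun_prop)]
  simp only [likelihoodRatio, add_sub_cancel_left]
  simp_rw [lintegral_gaussian_likelihood_mul hd hdσ (Real.coe_toNNReal _ hS.le)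
    (Real.coe_toNNReal (σ ^ 2 - d) (by linarith))]
  have hpos : 0 < √((σ ^ 2 + d) * (σ ^ 2 - d)) :=
    Real.sqrt_pos.2 (mul_pos (by linarith) (by linarith))
  have hSh : σ ^ 2 - δ ⬝ᵥ δ' ≠ 0 := by linarith
  have hm := measurable_ofLp_dotProduct δ
  have hm' := measurable_ofLp_dotProduct δ'
  rw [lintegral_const_mul _ (by fun_prop), lintegral_exp_quadratic_pair δ δ' hdσ h1 h2,
    ← ENNReal.ofReal_mul (by positivity)]
  have e : 1 - δ ⬝ᵥ δ' / σ ^ 2 = (σ ^ 2 - δ ⬝ᵥ δ') / σ ^ 2 := by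
    rw [sub_div, div_self hS.ne']
  congr 1
  rw [e, inv_div]
  field_simp

theorem dataLaw_eq_withDensity (n : ℕ) (β : Fin p → ℝ) {σ d : ℝ} (hd : 0 ≤ d) (hdσ : d < σ ^ 2)
    (δ : Fin p → ℝ) :
    dataLaw n (⟨β + δ, 1, √(σ ^ 2 - d)⟩ : Param p) =
      (dataLaw n (⟨β, 1, σ⟩ : Param p)).withDensity
        (fun z => ∏ i, likelihoodRatio β σ d δ (z i)) := by
  have h := observationLaw_eq_withDensity β hd hdσ δ
  have : IsProbabilityMeasure
      ((observationLaw (⟨β, 1, σ⟩ : Param p)).withDensity (likelihoodRatio β σ d δ)) := by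
    rw [← h]
    infer_instance
  unfold dataLaw
  rw [h, pi_withDensity _ _ (measurable_likelihoodRatio β σ d δ)]

theorem lintegral_prod_likelihoodRatio_mul (n : ℕ) (β : Fin p → ℝ) {σ d : ℝ} (hdσ : d < σ ^ 2)
    (δ δ' : Fin p → ℝ) (h1 : δ ⬝ᵥ δ = d) (h2 : δ' ⬝ᵥ δ' = d) :
    ∫⁻ z, (∏ i, likelihoodRatio β σ d δ (z i)) * (∏ i, likelihoodRatio β σ d δ' (z i))
        ∂dataLaw n (⟨β, 1, σ⟩ : Param p) =
      ENNReal.ofReal ((1 - δ ⬝ᵥ δ' / σ ^ 2)⁻¹) ^ n := by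
  simp_rw [← Finset.prod_mul_distrib]
  unfold dataLaw
  rw [lintegral_pi_prod (fun _ : Fin n => observationLaw (⟨β, 1, σ⟩ : Param p))
    (fun _ z => likelihoodRatio β σ d δ z * likelihoodRatio β σ d δ' z) (fun _ => by fun_prop)]
  simp_rw [lintegral_likelihoodRatio_mul β hdσ δ δ' h1 h2]
  simp

/-! ### From `χ²`-closeness to expected length -/

theorem IntervalProcedure.mul_measure_le_expectedLength (CI : IntervalProcedure n p) (θ : Param p)
    (a Δ : ℝ) :
    ENNReal.ofReal Δ * dataLaw n θ {z | a + Δ ≤ CI.upper z ∧ CI.lower z ≤ a} ≤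
      expectedLength θ CI := by
  refine le_trans ?_ (mul_meas_ge_le_lintegral
    ((CI.measurable_upper.sub CI.measurable_lower).ennreal_ofReal) (ENNReal.ofReal Δ))
  gcongr with z
  intro hz
  exact ENNReal.ofReal_le_ofReal (le_sub_iff_add_le.2 (by linarith [hz.1, hz.2]))

/-- Le Cam's method with a mixture of alternatives: if the alternatives shift the target by at
least `Δ` and their mixture has `χ²`-divergence at most `t²` from the law at `(β, I, σ)`, then a
confidence interval has expected length at least `Δ (1 - 2α - t)` there. -/
theorem expectedLength_ge_of_mixture {ι : Type*} [Fintype ι] [Nonempty ι] {α Δ t σ d : ℝ}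
    (hΔ : 0 ≤ Δ) (ht : 0 < t) (hdσ : d < σ ^ 2) (β : Fin p → ℝ) (δ : ι → Fin p → ℝ)
    (hδ : ∀ i, δ i ⬝ᵥ δ i = d) {Θ : Set (Param p)} {T : (Fin p → ℝ) → ℝ}
    (hβ : (⟨β, 1, σ⟩ : Param p) ∈ Θ) (hβδ : ∀ i, (⟨β + δ i, 1, √(σ ^ 2 - d)⟩ : Param p) ∈ Θ)
    (hT : ∀ i, T β + Δ ≤ T (β + δ i))
    (hχ : ∑ i, ∑ j, ENNReal.ofReal ((1 - δ i ⬝ᵥ δ j / σ ^ 2)⁻¹) ^ n ≤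
      (Fintype.card ι : ℝ≥0∞) ^ 2 * ENNReal.ofReal (1 + t ^ 2))
    {CI : IntervalProcedure n p} (hCI : CI ∈ confidenceIntervals n α Θ T) :
    ENNReal.ofReal (Δ * (1 - 2 * α - t)) ≤ expectedLength ⟨β, 1, σ⟩ CI := by
  have hd : 0 ≤ d := by
    rw [← hδ (Classical.arbitrary ι)]
    simpa using dotProduct_star_self_nonneg (δ (Classical.arbitrary ι))
  set P := dataLaw n (⟨β, 1, σ⟩ : Param p) with hP
  have hcov : ∀ θ ∈ Θ, ENNReal.ofReal (1 - α) ≤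
      dataLaw n θ {z | CI.lower z ≤ T θ.beta ∧ T θ.beta ≤ CI.upper z} :=
    fun θ hθ => hCI.trans (iInf₂_le θ hθ)
  set N : ℝ≥0∞ := (Fintype.card ι : ℝ≥0∞) with hN
  have hN0 : N ≠ 0 := by simp [hN]
  have hNt : N ≠ ⊤ := by simp [hN]
  set f : ι → (Fin n → Observation p) → ℝ≥0∞ :=
    fun i z => ∏ k, likelihoodRatio β σ d (δ i) (z k) with hf
  have hfm : ∀ i, Measurable (f i) := fun i => by
    simp only [hf]
    fun_prop
  have hlaw : ∀ i, dataLaw n (⟨β + δ i, 1, √(σ ^ 2 - d)⟩ : Param p) = P.withDensity (f i) :=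
    fun i => dataLaw_eq_withDensity n β hd hdσ (δ i)
  -- The density of the uniform mixture of the alternatives with respect to the null.
  set F : (Fin n → Observation p) → ℝ≥0∞ := fun z => N⁻¹ * ∑ i, f i z with hF
  have hFm : Measurable F := by
    simp only [hF]
    fun_prop
  have hset : ∀ A : Set (Fin n → Observation p), MeasurableSet A →
      ∫⁻ z in A, F z ∂P = N⁻¹ * ∑ i, dataLaw n (⟨β + δ i, 1, √(σ ^ 2 - d)⟩ : Param p) A := by
    intro A hA
    simp only [hF]
    rw [lintegral_const_mul _ (by fun_prop), lintegral_finsetSum _ (fun i _ => hfm i)]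
    simp_rw [hlaw, withDensity_apply _ hA]
  have hF1 : ∫⁻ z, F z ∂P = 1 := by
    have h := hset Set.univ MeasurableSet.univ
    rw [setLIntegral_univ] at h
    rw [h]
    simp [← hN, ENNReal.inv_mul_cancel hN0 hNt]
  have hF2 : ∫⁻ z, F z * F z ∂P ≤ 1 + (t.toNNReal : ℝ≥0∞) ^ 2 := by
    have h1 : ∀ z, F z * F z = N⁻¹ ^ 2 * ∑ i, ∑ j, f i z * f j z := by
      intro z
      simp only [hF]
      rw [← Finset.sum_mul_sum]
      ring
    simp_rw [h1]
    rw [lintegral_const_mul _ (by fun_prop), lintegral_finsetSum _ (fun i _ => by fun_prop)]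
    have h2 : ∀ i, ∫⁻ z, ∑ j, f i z * f j z ∂P =
        ∑ j, ENNReal.ofReal ((1 - δ i ⬝ᵥ δ j / σ ^ 2)⁻¹) ^ n := by
      intro i
      rw [lintegral_finsetSum _ (fun j _ => by fun_prop)]
      exact Finset.sum_congr rfl fun j _ =>
        lintegral_prod_likelihoodRatio_mul n β hdσ (δ i) (δ j) (hδ i) (hδ j)
    simp_rw [h2]
    calc N⁻¹ ^ 2 * ∑ i, ∑ j, ENNReal.ofReal ((1 - δ i ⬝ᵥ δ j / σ ^ 2)⁻¹) ^ n
        ≤ N⁻¹ ^ 2 * (N ^ 2 * ENNReal.ofReal (1 + t ^ 2)) := by gcongr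
      _ = ENNReal.ofReal (1 + t ^ 2) := by
        rw [← mul_assoc, ← mul_pow, ENNReal.inv_mul_cancel hN0 hNt, one_pow, one_mul]
      _ = 1 + (t.toNNReal : ℝ≥0∞) ^ 2 := by
        rw [ENNReal.ofReal_add zero_le_one (sq_nonneg t), ENNReal.ofReal_one,
          ENNReal.ofReal_pow ht.le]
        rfl
  set A : Set (Fin n → Observation p) := {z | T β + Δ ≤ CI.upper z} with hA
  have hAm : MeasurableSet A := measurableSet_le measurable_const CI.measurable_upper
  set B : Set (Fin n → Observation p) := {z | CI.lower z ≤ T β} with hB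
  have hBm : MeasurableSet B := measurableSet_le CI.measurable_lower measurable_const
  have hPB : ENNReal.ofReal (1 - α) ≤ P B :=
    (hcov _ hβ).trans (measure_mono fun z hz => hz.1)
  have hPA : ENNReal.ofReal (1 - α) ≤ P A + ENNReal.ofReal t := by
    refine le_trans ?_ (setLIntegral_le_add_of_lintegral_sq_le P F hFm hF1
      (Real.toNNReal_pos.2 ht) hF2 hAm)
    rw [hset A hAm]
    have h3 : ∀ i ∈ Finset.univ, ENNReal.ofReal (1 - α) ≤
        dataLaw n (⟨β + δ i, 1, √(σ ^ 2 - d)⟩ : Param p) A :=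
      fun i _ => (hcov _ (hβδ i)).trans (measure_mono fun z hz => (hT i).trans hz.2)
    have h4 := Finset.card_nsmul_le_sum _ _ _ h3
    rw [Finset.card_univ, nsmul_eq_mul, ← hN] at h4
    calc ENNReal.ofReal (1 - α) = N⁻¹ * (N * ENNReal.ofReal (1 - α)) := by
          rw [← mul_assoc, ENNReal.inv_mul_cancel hN0 hNt, one_mul]
      _ ≤ _ := by gcongr
  have hPA' : 1 - α ≤ P.real A + t := by
    rw [ENNReal.ofReal_le_iff_le_toReal (by simp), ENNReal.toReal_add (by simp) (by simp),
      ENNReal.toReal_ofReal ht.le] at hPA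
    exact hPA
  have hPB' : 1 - α ≤ P.real B := (ENNReal.ofReal_le_iff_le_toReal (by simp)).1 hPB
  -- On `A ∩ B` the interval contains `[T β, T β + Δ]`.
  have hAB : 1 - 2 * α - t ≤ P.real (A ∩ B) := by
    have h5 := measureReal_union_add_inter (μ := P) (s := A) hBm
    have h6 : P.real (A ∪ B) ≤ 1 := measureReal_le_one
    linarith
  calc ENNReal.ofReal (Δ * (1 - 2 * α - t)) ≤ ENNReal.ofReal (Δ * P.real (A ∩ B)) := by gcongr
    _ = ENNReal.ofReal Δ * P (A ∩ B) := by
      rw [ENNReal.ofReal_mul hΔ, ofReal_measureReal]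
    _ ≤ _ := CI.mul_measure_le_expectedLength _ (T β) Δ

/-! ### Block-sparse perturbations -/

/-- The vector which agrees with `w` at one coordinate `φ (i, g i)` of each block `i`, and vanishes
elsewhere. -/
noncomputable def blockVector (φ : Fin s × Fin b → Fin p) (w : Fin p → ℝ) (g : Fin s → Fin b) :
    Fin p → ℝ :=
  ∑ i, Pi.single (φ (i, g i)) (w (φ (i, g i)))

theorem blockVector_dotProduct (φ : Fin s × Fin b → Fin p) (w x : Fin p → ℝ) (g : Fin s → Fin b) :
    blockVector φ w g ⬝ᵥ x = ∑ i, w (φ (i, g i)) * x (φ (i, g i)) := by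
  simp [blockVector, sum_dotProduct]

theorem blockVector_apply_block {φ : Fin s × Fin b → Fin p} (hφ : Function.Injective φ)
    (w : Fin p → ℝ) (g : Fin s → Fin b) (i : Fin s) (c : Fin b) :
    blockVector φ w g (φ (i, c)) = if c = g i then w (φ (i, c)) else 0 := by
  rw [blockVector, Finset.sum_apply, Finset.sum_eq_single i]
  · split_ifs with h
    · rw [h, Pi.single_eq_same]
    · exact Pi.single_eq_of_ne (fun h' => h (by simpa using hφ h')) _
  · intro i' _ hi'
    exact Pi.single_eq_of_ne (fun h' => hi' (by simpa using (congrArg Prod.fst (hφ h')).symm)) _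
  · simp

theorem blockVector_dotProduct_blockVector {φ : Fin s × Fin b → Fin p}
    (hφ : Function.Injective φ) (w : Fin p → ℝ) (g g' : Fin s → Fin b) :
    blockVector φ w g ⬝ᵥ blockVector φ w g' =
      ∑ i, if g i = g' i then w (φ (i, g i)) ^ 2 else 0 := by
  simp_rw [blockVector_dotProduct, blockVector_apply_block hφ, mul_ite, mul_zero, sq]

theorem l0norm_add_blockVector_le (φ : Fin s × Fin b → Fin p) (w β : Fin p → ℝ)
    (g : Fin s → Fin b) : l0norm (β + blockVector φ w g) ≤ l0norm β + s := by
  have hsub : {j | (β + blockVector φ w g) j ≠ 0} ⊆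
      {j | β j ≠ 0} ∪ Set.range fun i => φ (i, g i) := by
    intro j hj
    by_contra hcon
    simp only [Set.mem_union, Set.mem_ofPred_eq, Set.mem_range, not_or, not_not, not_exists] at hcon
    refine hj ?_
    rw [Pi.add_apply, hcon.1, zero_add, blockVector, Finset.sum_apply]
    exact Finset.sum_eq_zero fun i _ => Pi.single_eq_of_ne (fun h => hcon.2 i h.symm) _
  refine (Set.ncard_le_ncard hsub (Set.toFinite _)).trans ((Set.ncard_union_le _ _).trans ?_)
  refine Nat.add_le_add_left ?_ _
  rw [← Set.image_univ]
  refine (Set.ncard_image_le Set.finite_univ).trans ?_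
  simp [Set.ncard_univ]

theorem inv_one_sub_le_exp {h : ℝ} (h0 : 0 ≤ h) (h1 : h ≤ 1 / 2) :
    (1 - h)⁻¹ ≤ Real.exp (2 * h) := by
  refine le_trans ?_ (Real.add_one_le_exp (2 * h))
  rw [inv_le_iff_one_le_mul₀ (by linarith)]
  nlinarith

/-- For fixed `g` the inner sum factors over the blocks, and in each block exactly one of the `b`
choices agrees with `g`. Up to normalisation this is the generating function of the number of
agreements. -/
theorem sum_sum_prod_ite_eq (s b : ℕ) (c : ℝ) :
    ∑ g : Fin s → Fin b, ∑ g' : Fin s → Fin b, ∏ i, (if g i = g' i then c else 1) =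
      ((b : ℝ) ^ s) * (b + (c - 1)) ^ s := by
  have h1 : ∀ g : Fin s → Fin b, ∑ g' : Fin s → Fin b, ∏ i, (if g i = g' i then c else 1) =
      (b + (c - 1)) ^ s := by
    intro g
    rw [← Fintype.prod_sum (fun i (x : Fin b) => if g i = x then c else 1)]
    have h2 : ∀ i, ∑ x, (if g i = x then c else 1) = b + (c - 1) := by
      intro i
      have : ∀ x, (if g i = x then c else (1 : ℝ)) = 1 + if g i = x then c - 1 else 0 := by
        intro x
        split_ifs <;> ring
      simp [this, Finset.sum_add_distrib]
    simp [h2]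
  simp [h1]

/-- The lower bound obtained by perturbing one coordinate in each of `s` disjoint blocks of `b`
coordinates by `ρ`. -/
theorem expectedLength_ge_of_blocks {α t σ ρ x M₁ M₂ : ℝ} {k k₁ : ℕ} (hb : 0 < b) (ht : 0 < t)
    (hσ : 0 < σ) (hρ : 0 ≤ ρ) (hx : 0 ≤ x) {φ : Fin s × Fin b → Fin p}
    (hφ : Function.Injective φ) {ξ : Fin p → ℝ} (hξ : ∀ i, x ≤ |ξ (φ i)|)
    (hsρ : s * (ρ ^ 2 / σ ^ 2) ≤ 1 / 2) (hk : k₁ + s ≤ k) {β : Fin p → ℝ}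
    (hβ : (⟨β, 1, σ⟩ : Param p) ∈ paramSpace p M₁ M₂ k₁)
    (hχ : (1 + (Real.exp (2 * n * (ρ ^ 2 / σ ^ 2)) - 1) / b) ^ s ≤ 1 + t ^ 2)
    {CI : IntervalProcedure n p}
    (hCI : CI ∈ confidenceIntervals n α (paramSpace p M₁ M₂ k) (fun v => ξ ⬝ᵥ v)) :
    ENNReal.ofReal (ρ * s * x * (1 - 2 * α - t)) ≤ expectedLength ⟨β, 1, σ⟩ CI := by
  have hbne : NeZero b := ⟨hb.ne'⟩
  have hb' : (0 : ℝ) < b := by exact_mod_cast hb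
  -- The signs follow `ξ`, so that the contributions of the blocks to `ξ ⬝ᵥ β` add up.
  set w : Fin p → ℝ := fun j => if 0 ≤ ξ j then ρ else -ρ with hw
  have hw2 : ∀ j, w j ^ 2 = ρ ^ 2 := by
    intro j
    simp only [hw]
    split_ifs <;> ring
  have hwξ : ∀ j, ξ j * w j = ρ * |ξ j| := by
    intro j
    simp only [hw]
    split_ifs with h
    · rw [abs_of_nonneg h, mul_comm]
    · rw [abs_of_neg (not_le.1 h)]
      ring
  have hdot : ∀ g g' : Fin s → Fin b, blockVector φ w g ⬝ᵥ blockVector φ w g' =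
      ∑ i, if g i = g' i then ρ ^ 2 else 0 := by
    intro g g'
    simp_rw [blockVector_dotProduct_blockVector hφ, hw2]
  have hself : ∀ g : Fin s → Fin b, blockVector φ w g ⬝ᵥ blockVector φ w g = s * ρ ^ 2 := by
    intro g
    simp [hdot]
  have hσ2 : 0 < σ ^ 2 := by positivity
  have hsρ' : s * ρ ^ 2 ≤ σ ^ 2 / 2 := by
    rw [← mul_div_assoc, div_le_iff₀ hσ2] at hsρ
    linarith
  have hd : (s : ℝ) * ρ ^ 2 < σ ^ 2 := by linarith
  refine expectedLength_ge_of_mixture (by positivity) ht hd β (fun g => blockVector φ w g) hself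
    ?_ ?_ ?_ ?_ hCI
  · exact ⟨hβ.1.trans (by omega), hβ.2⟩
  · intro g
    refine ⟨((l0norm_add_blockVector_le φ w β g).trans (Nat.add_le_add_right hβ.1 s)).trans hk,
      hβ.2.1, Real.sqrt_pos.2 (by linarith), le_trans ?_ hβ.2.2.2⟩
    refine Real.sqrt_le_iff.2 ⟨hσ.le, ?_⟩
    have : 0 ≤ (s : ℝ) * ρ ^ 2 := by positivity
    linarith
  · intro g
    rw [dotProduct_add, dotProduct_comm ξ (blockVector φ w g), blockVector_dotProduct]
    have h1 : ∑ _i : Fin s, ρ * x ≤ ∑ i, w (φ (i, g i)) * ξ (φ (i, g i)) := by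
      refine Finset.sum_le_sum fun i _ => ?_
      rw [mul_comm (w _), hwξ]
      exact mul_le_mul_of_nonneg_left (hξ _) hρ
    simp only [Finset.sum_const, Finset.card_univ, Fintype.card_fin, nsmul_eq_mul] at h1
    linarith
  -- From `(1 - h)⁻¹ ≤ exp (2h)`; here `h` is a sum over the agreeing blocks, so the exponential is
  -- a product over blocks.
  · have hterm : ∀ g g' : Fin s → Fin b,
        ENNReal.ofReal ((1 - blockVector φ w g ⬝ᵥ blockVector φ w g' / σ ^ 2)⁻¹) ^ n ≤
          ENNReal.ofReal (∏ i, if g i = g' i then Real.exp (2 * n * (ρ ^ 2 / σ ^ 2)) else 1) := by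
      intro g g'
      have hle : blockVector φ w g ⬝ᵥ blockVector φ w g' ≤ s * ρ ^ 2 := by
        rw [hdot]
        refine (Finset.sum_le_card_nsmul _ _ (ρ ^ 2) fun i _ => ?_).trans (by simp)
        split_ifs
        · exact le_rfl
        · positivity
      have hge : 0 ≤ blockVector φ w g ⬝ᵥ blockVector φ w g' := by
        rw [hdot]
        refine Finset.sum_nonneg fun i _ => ?_
        split_ifs
        · positivity
        · exact le_rfl
      have hh : blockVector φ w g ⬝ᵥ blockVector φ w g' / σ ^ 2 ≤ 1 / 2 := by
        rw [div_le_iff₀ hσ2]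
        linarith
      rw [← ENNReal.ofReal_pow (inv_nonneg.2 (by linarith))]
      refine ENNReal.ofReal_le_ofReal ?_
      refine (pow_le_pow_left₀ (inv_nonneg.2 (by linarith))
        (inv_one_sub_le_exp (by positivity) hh) n).trans (le_of_eq ?_)
      rw [← Real.exp_nat_mul, hdot, Finset.sum_div, Finset.mul_sum, Finset.mul_sum, Real.exp_sum]
      refine Finset.prod_congr rfl fun i _ => ?_
      split_ifs
      · ring_nf
      · simp
    have hpos : ∀ g g' : Fin s → Fin b,
        0 ≤ ∏ i, if g i = g' i then Real.exp (2 * n * (ρ ^ 2 / σ ^ 2)) else 1 := by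
      intro g g'
      refine Finset.prod_nonneg fun i _ => ?_
      split_ifs <;> positivity
    refine (Finset.sum_le_sum fun g _ => Finset.sum_le_sum fun g' _ => hterm g g').trans ?_
    simp_rw [← ENNReal.ofReal_sum_of_nonneg (fun g' _ => hpos _ g')]
    rw [← ENNReal.ofReal_sum_of_nonneg (fun g _ => Finset.sum_nonneg fun g' _ => hpos g g'),
      sum_sum_prod_ite_eq]
    have hcard : (Fintype.card (Fin s → Fin b) : ℝ≥0∞) ^ 2 = ENNReal.ofReal (((b : ℝ) ^ s) ^ 2) := by
      rw [ENNReal.ofReal_pow (by positivity), ENNReal.ofReal_pow (by positivity)]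
      simp
    rw [hcard, ← ENNReal.ofReal_mul (by positivity)]
    refine ENNReal.ofReal_le_ofReal ?_
    have hfac : (b : ℝ) + (Real.exp (2 * n * (ρ ^ 2 / σ ^ 2)) - 1) =
        b * (1 + (Real.exp (2 * n * (ρ ^ 2 / σ ^ 2)) - 1) / b) := by
      field_simp
    rw [hfac, mul_pow, ← mul_assoc, ← sq]
    exact mul_le_mul_of_nonneg_left hχ (by positivity)

/-! ### Loadings and the two regimes of the lower bound -/

theorem exists_abs_eq_linfNorm {ξ : Fin p → ℝ} (hξ : ξ ≠ 0) :
    ∃ j, ξ j ≠ 0 ∧ |ξ j| = linfNorm ξ := by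
  obtain ⟨i, hi⟩ := Function.ne_iff.1 hξ
  have : Nonempty (Fin p) := ⟨i⟩
  obtain ⟨j, hj⟩ := exists_eq_ciSup_of_finite (f := fun j => |ξ j|)
  refine ⟨j, fun h0 => hi ?_, hj⟩
  have h1 : |ξ i| ≤ |ξ j| := by
    rw [hj]
    exact le_ciSup (f := fun j => |ξ j|) (Set.finite_range _).bddAbove i
  simpa [h0] using h1

theorem linfNorm_nonneg (ξ : Fin p → ℝ) : 0 ≤ linfNorm ξ :=
  Real.iSup_nonneg fun _ => abs_nonneg _

theorem linfNorm_div_le_abs {q : ℕ} {cbar : ℝ} (hcbar : 0 < cbar) {ξ : Fin p → ℝ}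
    (hξ : ξ ∈ loadings p q cbar) {i : Fin p} (hi : ξ i ≠ 0) : linfNorm ξ / cbar ≤ |ξ i| := by
  obtain ⟨j, hj, hj'⟩ := exists_abs_eq_linfNorm hξ.2.1
  have h := hξ.2.2 j i hj hi
  rw [div_le_iff₀ (abs_pos.2 hi), hj'] at h
  rw [div_le_iff₀ hcbar]
  linarith

theorem exists_injective_blocks {ξ : Fin p → ℝ} {s b : ℕ} (h : s * b ≤ l0norm ξ) :
    ∃ φ : Fin s × Fin b → Fin p, Function.Injective φ ∧ ∀ i, ξ (φ i) ≠ 0 := by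
  classical
  have hcard : Fintype.card (Fin s × Fin b) ≤ Fintype.card {j // ξ j ≠ 0} := by
    rw [Fintype.card_prod, Fintype.card_fin, Fintype.card_fin, ← Nat.card_eq_fintype_card]
    exact h
  obtain ⟨e⟩ := Function.Embedding.nonempty_of_card_le hcard
  exact ⟨fun i => (e i).1, Subtype.val_injective.comp e.injective, fun i => (e i).2⟩

/-- The parametric lower bound, from the perturbation of a single coordinate. -/
theorem expectedLength_ge_parametric {α t a σ M₁ M₂ : ℝ} {k k₁ : ℕ} (hn : 1 ≤ n)
    (ht : 0 < t) (ha : 0 ≤ a) (ha' : a ^ 2 ≤ 1 / 2) (hat : Real.exp (2 * a ^ 2) ≤ 1 + t ^ 2)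
    {ξ : Fin p → ℝ} (hξ : ξ ≠ 0) (hk : k₁ + 1 ≤ k) {β : Fin p → ℝ}
    (hβ : (⟨β, 1, σ⟩ : Param p) ∈ paramSpace p M₁ M₂ k₁) {CI : IntervalProcedure n p}
    (hCI : CI ∈ confidenceIntervals n α (paramSpace p M₁ M₂ k) (fun v => ξ ⬝ᵥ v)) :
    ENNReal.ofReal (a * σ / √n * linfNorm ξ * (1 - 2 * α - t)) ≤
      expectedLength ⟨β, 1, σ⟩ CI := by
  obtain ⟨j, -, hj⟩ := exists_abs_eq_linfNorm hξ
  have hσ : 0 < σ := hβ.2.2.1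
  have hn' : (1 : ℝ) ≤ n := by exact_mod_cast hn
  have hn0 : (0 : ℝ) < n := by linarith
  have hρ : (a * σ / √n) ^ 2 / σ ^ 2 = a ^ 2 / n := by
    rw [div_pow, mul_pow, Real.sq_sqrt hn0.le]
    field_simp
  -- A single alternative, located at a largest coordinate of `ξ`; the second moment bound becomes
  -- `exp (2a²)`.
  have h := expectedLength_ge_of_blocks (n := n) (s := 1) (b := 1) (α := α) (t := t)
    (ρ := a * σ / √n) (x := linfNorm ξ) (φ := fun _ => j) one_pos ht hσ (by positivity)
    (linfNorm_nonneg ξ) (Function.injective_of_subsingleton _) (fun _ => hj.ge)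
    (by
      rw [hρ, Nat.cast_one, one_mul]
      exact (div_le_self (sq_nonneg a) hn').trans ha')
    hk hβ
    (by
      have : 2 * (n : ℝ) * (a ^ 2 / n) = 2 * a ^ 2 := by field_simp
      rw [hρ, this]
      simpa using hat) hCI
  simpa using h

/-- The lower bound of order `s √(log p / n)` for loadings with `q` nonzero coordinates, where
`s² ≪ q`. -/
theorem expectedLength_ge_dense {α t a c cbar σ M₁ M₂ : ℝ} {k k₁ s q : ℕ} (hn : 1 ≤ n) (hp : 2 ≤ p)
    (ht : 0 < t) (ha : 0 ≤ a) (hcbar : 0 < cbar) {ξ : Fin p → ℝ} (hξ : ξ ∈ loadings p q cbar)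
    (hs : 0 < s) (hsq : s ≤ q) (hsn : (s : ℝ) ≤ c * (n / Real.log p)) (hac : c * a ^ 2 ≤ 1 / 2)
    (hχ : 2 * (s : ℝ) ^ 2 / q * (p : ℝ) ^ (2 * a ^ 2) ≤ Real.log (1 + t ^ 2))
    (hk : k₁ + s ≤ k) {β : Fin p → ℝ}
    (hβ : (⟨β, 1, σ⟩ : Param p) ∈ paramSpace p M₁ M₂ k₁) {CI : IntervalProcedure n p}
    (hCI : CI ∈ confidenceIntervals n α (paramSpace p M₁ M₂ k) (fun v => ξ ⬝ᵥ v)) :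
    ENNReal.ofReal (a * σ * √(Real.log p / n) * s * (linfNorm ξ / cbar) * (1 - 2 * α - t)) ≤
      expectedLength ⟨β, 1, σ⟩ CI := by
  have hσ : 0 < σ := hβ.2.2.1
  have hn0 : (0 : ℝ) < n := by exact_mod_cast hn
  have hp' : (1 : ℝ) < p := by exact_mod_cast hp
  have hp0 : (0 : ℝ) < p := by linarith
  have hlog : 0 < Real.log p := Real.log_pos hp'
  have hs' : (0 : ℝ) < s := by exact_mod_cast hs
  set b := q / s with hb
  have hb0 : 0 < b := Nat.div_pos hsq hs
  have hb0' : (0 : ℝ) < b := by exact_mod_cast hb0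
  -- Rounding `q / s` down costs at most a factor 2, since `s ≤ q`.
  have hqb : (q : ℝ) ≤ 2 * s * b := by
    have h1 : q < s * b + s := by
      rw [hb, ← Nat.mul_succ]
      exact Nat.lt_mul_div_succ q hs
    have h2 : s ≤ s * b := Nat.le_mul_of_pos_right s hb0
    have h3 : q ≤ 2 * s * b := by linarith
    exact_mod_cast h3
  have hq0 : (0 : ℝ) < q := by
    have : 0 < q := lt_of_lt_of_le hs hsq
    exact_mod_cast this
  obtain ⟨φ, hφ, hφξ⟩ := exists_injective_blocks (ξ := ξ) (s := s) (b := b)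
    (by
      rw [hξ.1]
      exact Nat.mul_div_le q s)
  have hρ : (a * σ * √(Real.log p / n)) ^ 2 / σ ^ 2 = a ^ 2 * (Real.log p / n) := by
    rw [mul_pow, mul_pow, Real.sq_sqrt (by positivity)]
    field_simp
  refine expectedLength_ge_of_blocks hb0 ht hσ (by positivity)
    (div_nonneg (linfNorm_nonneg ξ) hcbar.le) hφ (fun i => linfNorm_div_le_abs hcbar hξ (hφξ i))
    ?_ hk hβ ?_ hCI
  · rw [hρ]
    calc (s : ℝ) * (a ^ 2 * (Real.log p / n))
        ≤ c * (n / Real.log p) * (a ^ 2 * (Real.log p / n)) := by gcongr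
      _ = c * a ^ 2 := by field_simp
      _ ≤ 1 / 2 := hac
  · have hexp : Real.exp (2 * n * (a ^ 2 * (Real.log p / n))) = (p : ℝ) ^ (2 * a ^ 2) := by
      rw [Real.rpow_def_of_pos hp0]
      congr 1
      field_simp
    rw [hρ, hexp]
    have hL : 1 ≤ (p : ℝ) ^ (2 * a ^ 2) := Real.one_le_rpow hp'.le (by positivity)
    set lam := (p : ℝ) ^ (2 * a ^ 2)
    have hsb : (s : ℝ) / b ≤ 2 * s ^ 2 / q := by
      rw [div_le_div_iff₀ hb0' hq0]
      nlinarith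
    calc (1 + (lam - 1) / b) ^ s
        ≤ Real.exp ((lam - 1) / b) ^ s := by
          have : 0 ≤ (lam - 1) / b := div_nonneg (by linarith) hb0'.le
          refine pow_le_pow_left₀ (by linarith) ?_ s
          rw [add_comm]
          exact Real.add_one_le_exp _
      _ = Real.exp (s / b * (lam - 1)) := by
          rw [← Real.exp_nat_mul]
          congr 1
          ring
      _ ≤ Real.exp (Real.log (1 + t ^ 2)) := by
          refine Real.exp_le_exp.2 (le_trans ?_ hχ)
          refine mul_le_mul hsb (by linarith) (by linarith) (by positivity)
      _ = 1 + t ^ 2 := Real.exp_log (by positivity)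

/-- Defines "large `p`": the first bound gives `k ≤ q`, so that blocks are nonempty; the second
controls the `χ²`-divergence after half of the gap `γq - 2γ` has been spent on `p^(2a²)`. -/
theorem exists_forall_rpow_bounds {c cq γ γq ε : ℝ} (hcq : 0 < cq) (hγ : 0 ≤ γ)
    (hγq : 2 * γ < γq) (hε : 0 < ε) :
    ∃ R : ℝ, 1 ≤ R ∧ ∀ x, R ≤ x → c * x ^ γ ≤ cq * x ^ γq ∧
      2 * c ^ 2 / cq * x ^ (-((γq - 2 * γ) / 2)) ≤ ε := by
  have h1 : ∀ᶠ x : ℝ in Filter.atTop, c / cq ≤ x ^ (γq - γ) :=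
    (tendsto_rpow_atTop (by linarith)).eventually_ge_atTop _
  have h2 : ∀ᶠ x : ℝ in Filter.atTop, 2 * c ^ 2 / cq * x ^ (-((γq - 2 * γ) / 2)) ≤ ε := by
    have h := (tendsto_rpow_neg_atTop (y := (γq - 2 * γ) / 2) (by linarith)).const_mul
      (2 * c ^ 2 / cq)
    rw [mul_zero] at h
    exact h.eventually_le_const hε
  obtain ⟨R, hR⟩ := Filter.eventually_atTop.1 (h1.and h2)
  refine ⟨max R 1, le_max_right _ _, fun x hx => ?_⟩
  have hx1 : 1 ≤ x := (le_max_right _ _).trans hx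
  obtain ⟨h3, h4⟩ := hR x ((le_max_left _ _).trans hx)
  refine ⟨?_, h4⟩
  have hpos : 0 < x ^ γ := Real.rpow_pos_of_pos (by linarith) _
  rw [Real.rpow_sub (by linarith), div_le_div_iff₀ hcq hpos] at h3
  linarith

end HDRegression

/-! ### Choice of constants and conclusion -/

theorem theorem6
    (α c γ cq γq ζ₀ cbar M₁ M₂ : ℝ)
    (hα : 0 < α) (hα' : α < 1 / 2)
    (hc : 0 < c) (hγ : 0 ≤ γ) (hγ' : γ < 1 / 2)
    (hcq : 0 < cq) (hγq : 2 * γ < γq) (hγq' : γq ≤ 1)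
    (hζ₀ : 0 < ζ₀) (hζ₀' : ζ₀ < 1) (hcbar : 1 ≤ cbar)
    (hM₁ : 1 < M₁) (hM₂ : 0 < M₂) :
    ∃ c₁ : ℝ, 0 < c₁ ∧
      ∀ n p k k₁ q : ℕ, 1 ≤ n → 2 ≤ p →
        (k : ℝ) ≤ c * min ((p : ℝ) ^ γ) ((n : ℝ) / Real.log p) →
        cq * (p : ℝ) ^ γq ≤ (q : ℝ) →
        (k₁ : ℝ) ≤ (1 - ζ₀) * (k : ℝ) - 1 →
        ∀ (β : Fin p → ℝ) (σ : ℝ),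
          (⟨β, 1, σ⟩ : HDRegression.Param p) ∈ HDRegression.paramSpace p M₁ M₂ k₁ →
          ∀ ξ ∈ HDRegression.loadings p q cbar,
            ENNReal.ofReal
                (c₁ * HDRegression.linfNorm ξ * (k : ℝ) * √(Real.log p / (n : ℝ)) * σ) ≤
              ⨅ CI ∈ HDRegression.confidenceIntervals n α
                  (HDRegression.paramSpace p M₁ M₂ k) (fun b => ξ ⬝ᵥ b),
                HDRegression.expectedLength ⟨β, 1, σ⟩ CI := by
  -- Half of the slack, so that the factor `1 - 2α - t` equals `t`.
  set t : ℝ := (1 - 2 * α) / 2 with ht_def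
  have ht : 0 < t := by linarith
  have htα : 1 - 2 * α - t = t := by linarith
  have hlt : 0 < Real.log (1 + t ^ 2) := Real.log_pos (by nlinarith)
  set κ : ℝ := γq - 2 * γ with hκ_def
  have hκ : 0 < κ := by linarith
  obtain ⟨R, hR1, hR⟩ := HDRegression.exists_forall_rpow_bounds (c := c) hcq hγ hγq hlt
  -- The first term keeps the removed noise variance below `σ² / 2`; the second gives `p^(2a²) ≤
  -- p^(κ/2)`.
  set a : ℝ := √(min (1 / (2 * c)) (κ / 4)) with ha_def
  have ha : 0 < a := Real.sqrt_pos.2 (lt_min (by positivity) (by positivity))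
  have ha2 : a ^ 2 = min (1 / (2 * c)) (κ / 4) :=
    Real.sq_sqrt (lt_min (by positivity) (by positivity)).le
  set a' : ℝ := √(min (1 / 2) (Real.log (1 + t ^ 2) / 2)) with ha'_def
  have ha' : 0 < a' := Real.sqrt_pos.2 (lt_min (by positivity) (by positivity))
  have ha2' : a' ^ 2 = min (1 / 2) (Real.log (1 + t ^ 2) / 2) :=
    Real.sq_sqrt (lt_min (by positivity) (by positivity)).le
  have hcbar0 : 0 < cbar := by linarith
  refine ⟨min (a * ζ₀ * t / cbar) (a' * t / (c * R * √R)), lt_min (by positivity)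
    (by positivity), ?_⟩
  intro n p k k₁ q hn hp hk hq hk₁ β σ hβ ξ hξ
  refine le_iInf₂ fun CI hCI => ?_
  have hσ : 0 < σ := hβ.2.2.1
  have hn0 : (0 : ℝ) < n := by exact_mod_cast hn
  have hp' : (2 : ℝ) ≤ p := by exact_mod_cast hp
  have hp0 : (0 : ℝ) < p := by linarith
  have hlog : 0 < Real.log p := Real.log_pos (by linarith)
  have hξ0 := HDRegression.linfNorm_nonneg ξ
  -- `k = 0` would force `k₁ ≤ -1`.
  have hk0 : (0 : ℝ) < k := by
    by_contra hcon
    have : (0 : ℝ) ≤ k₁ := Nat.cast_nonneg _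
    nlinarith
  have hkp : (k : ℝ) ≤ c * (p : ℝ) ^ γ :=
    hk.trans (mul_le_mul_of_nonneg_left (min_le_left _ _) hc.le)
  have hkn : (k : ℝ) ≤ c * (n / Real.log p) :=
    hk.trans (mul_le_mul_of_nonneg_left (min_le_right _ _) hc.le)
  rcases le_or_gt R p with hpR | hpR
  · obtain ⟨hE1, hE2⟩ := hR p hpR
    have hs_lt : (⌈ζ₀ * k⌉₊ : ℝ) < ζ₀ * k + 1 := Nat.ceil_lt_add_one (by positivity)
    have hs_ge : ζ₀ * k ≤ (⌈ζ₀ * k⌉₊ : ℝ) := Nat.le_ceil _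
    set s := ⌈ζ₀ * k⌉₊ with hs_def
    have hs : 0 < s := Nat.ceil_pos.2 (by positivity)
    -- The `-1` in the bound on `k₁` absorbs the rounding up of `ζ₀ k`.
    have hks : k₁ + s ≤ k := by
      have : (k₁ : ℝ) + s ≤ k := by linarith
      exact_mod_cast this
    have hsk : (s : ℝ) ≤ k := by
      have : s ≤ k := by omega
      exact_mod_cast this
    have hsq : s ≤ q := by
      have : (s : ℝ) ≤ q := by linarith
      exact_mod_cast this
    have hac : c * a ^ 2 ≤ 1 / 2 := by
      calc c * a ^ 2 ≤ c * (1 / (2 * c)) := by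
            rw [ha2]
            gcongr
            exact min_le_left _ _
        _ = 1 / 2 := by field_simp
    have hχ : 2 * (s : ℝ) ^ 2 / q * (p : ℝ) ^ (2 * a ^ 2) ≤ Real.log (1 + t ^ 2) := by
      refine le_trans ?_ hE2
      have h2a : 2 * a ^ 2 ≤ κ / 2 := by
        have := min_le_right (1 / (2 * c)) (κ / 4)
        linarith
      have hpow : (p : ℝ) ^ (2 * a ^ 2) ≤ (p : ℝ) ^ (κ / 2) :=
        Real.rpow_le_rpow_of_exponent_le (by linarith) h2a
      calc 2 * (s : ℝ) ^ 2 / q * (p : ℝ) ^ (2 * a ^ 2)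
          ≤ 2 * (c * (p : ℝ) ^ γ) ^ 2 / (cq * (p : ℝ) ^ γq) * (p : ℝ) ^ (κ / 2) := by
            gcongr
            exact hsk.trans hkp
        _ = 2 * c ^ 2 / cq * ((p : ℝ) ^ γ * (p : ℝ) ^ γ / (p : ℝ) ^ γq * (p : ℝ) ^ (κ / 2)) := by
            field_simp
        _ = 2 * c ^ 2 / cq * (p : ℝ) ^ (-(κ / 2)) := by
            rw [← Real.rpow_add hp0, ← Real.rpow_sub hp0, ← Real.rpow_add hp0]
            congr 2
            rw [hκ_def]
            ring
    refine le_trans (ENNReal.ofReal_le_ofReal ?_) (HDRegression.expectedLength_ge_dense hn hp ht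
      ha.le hcbar0 hξ hs hsq (hsk.trans hkn) hac hχ hks hβ hCI)
    rw [htα]
    calc min (a * ζ₀ * t / cbar) (a' * t / (c * R * √R)) * HDRegression.linfNorm ξ * k *
          √(Real.log p / n) * σ
        ≤ a * ζ₀ * t / cbar * HDRegression.linfNorm ξ * k * √(Real.log p / n) * σ := by
          gcongr
          exact min_le_left _ _
      _ = a * σ * √(Real.log p / n) * (ζ₀ * k) * (HDRegression.linfNorm ξ / cbar) * t := by ring
      _ ≤ _ := by gcongr
  -- Here `p < R`, so `k ≤ c R` and `log p ≤ R`: the target rate is at most a constant times `1 /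
  -- √n`.
  · have hks : k₁ + 1 ≤ k := by
      have : (k₁ : ℝ) + 1 ≤ k := by nlinarith
      exact_mod_cast this
    have ha1 : a' ^ 2 ≤ 1 / 2 := ha2' ▸ min_le_left _ _
    have hat : Real.exp (2 * a' ^ 2) ≤ 1 + t ^ 2 := by
      rw [← Real.le_log_iff_exp_le (by positivity)]
      have := min_le_right (1 / 2) (Real.log (1 + t ^ 2) / 2)
      linarith
    refine le_trans (ENNReal.ofReal_le_ofReal ?_) (HDRegression.expectedLength_ge_parametric hn ht
      ha'.le ha1 hat hξ.2.1 hks hβ hCI)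
    rw [htα]
    have hkR : (k : ℝ) ≤ c * R := by
      refine hkp.trans (mul_le_mul_of_nonneg_left ?_ hc.le)
      calc (p : ℝ) ^ γ ≤ (p : ℝ) ^ (1 : ℝ) :=
            Real.rpow_le_rpow_of_exponent_le (by linarith) (by linarith)
        _ = p := Real.rpow_one _
        _ ≤ R := hpR.le
    have hlogR : √(Real.log p / n) ≤ √R / √n := by
      rw [← Real.sqrt_div (by linarith)]
      refine Real.sqrt_le_sqrt (div_le_div_of_nonneg_right ?_ hn0.le)
      have := Real.log_le_sub_one_of_pos hp0
      linarith
    calc min (a * ζ₀ * t / cbar) (a' * t / (c * R * √R)) * HDRegression.linfNorm ξ * k *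
          √(Real.log p / n) * σ
        ≤ a' * t / (c * R * √R) * HDRegression.linfNorm ξ * (c * R) * (√R / √n) * σ := by
          gcongr
          exact min_le_right _ _
      _ = a' * σ / √n * HDRegression.linfNorm ξ * t := by
          have : 0 < √R := Real.sqrt_pos.2 (by linarith)
          field_simp
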